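/- Let $n\ge 1$, $\mathbb D^n=\{z\in\mathbb C^n: |z_k|<1\ \forall k\}$, $\overline{\mathbb D^n}=\{z: |z_k|\le 1\ \forall k\}$, $\mathbb T^n=\{z: |z_k|=1\ \forall k\}$, and let $\hat z_j=(z_1,\dots,z_{j-1},z_{j+1},\dots,z_n)$. Suppose that $F:\overline{\mathbb D^n}\to\mathbb C^n$ has the form $$F_j(z)=\bigl(z_j-u_j(\hat z_j)\bigr)\,G_j(z),\qquad j=1,\dots,n,$$ where $u_j:\overline{\mathbb D^{n-1}}\to\overline{\mathbb D}$ and $G_j:\overline{\mathbb D^n}\to\mathbb C$ are continuous, $u_j$ is holomorphic on $\mathbb D^{n-1}$, $G_j$ is holomorphic on $\mathbb D^n$, and $$\operatorname{Re}\bigl((1-\overline{z_j}\,u_j(\hat z_j))\,G_j(z)\bigr)<0\qquad\text{for all } z\in\overline{\mathbb D^n},\ j=1,\dots,n.$$ Then the following two properties hold. 1. (Holomorphic flow.) $F$ is holomorphic on $\mathbb D^n$ and continuous on $\mathbb D^n\cup\mathbb T^n$, and it generates a flow $(\varphi^t)_{t\ge 0}$ on $\mathbb D^n\cup\mathbb T^n$: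 for every $z\in\mathbb D^n\cup\mathbb T^n$ the curve $t\mapsto\varphi^t(z)$, $t\ge 0$, stays in $\mathbb D^n\cup\mathbb T^n$ and solves $\dot x=F(x)$, $x(0)=z$ (with the one-sided derivative at $t=0$); any solution of this initial value problem on an interval $[0,T]$ with values in $\mathbb D^n\cup\mathbb T^n$ coincides with it there; $\varphi^0=\mathrm{id}$ and $\varphi^{t+s}=\varphi^t\circ\varphi^s$ for $t,s\ge 0$; and $(t,z)\mapsto\varphi^t(z)$ is continuous on $[0,\infty)\times(\mathbb D^n\cup\mathbb T^n)$. Moreover, for every $t\ge 0$, $\varphi^t$ maps $\mathbb D^n$ into $\mathbb D^n$ and is holomorphic on $\mathbb D^n$. 2. (Forward invariance.) For every $t>0$ there is $R_t\in(0,1)$ such that $|\varphi^t_j(z)|<R_t$ for all $z\in\mathbb T^n$ and all $j=1,\dots,n$. -/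

import Mathlib

open Set

/-- The open unit polydisc in `ℂ^ι`. -/
def openPolydisc (ι : Type) : Set (ι → ℂ) := {z | ∀ k, ‖z k‖ < 1}

/-- The closed unit polydisc in `ℂ^ι`. -/
def closedPolydisc (ι : Type) : Set (ι → ℂ) := {z | ∀ k, ‖z k‖ ≤ 1}

/-- The unit torus (distinguished boundary of the polydisc) in `ℂ^ι`. -/
def unitTorus (ι : Type) : Set (ι → ℂ) := {z | ∀ k, ‖z k‖ = 1}

/-- The vector `z` with its `j`-th coordinate deleted; the remaining coordinates keep their
labels, so the result has coordinates indexed by `{i // i ≠ j}`. -/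
def deleteCoord {n : ℕ} (j : Fin n) (z : Fin n → ℂ) : {i : Fin n // i ≠ j} → ℂ := fun i => z i

/-- `φ` (considered for times `t ≥ 0` and initial states in `S`) is the continuous semiflow on `S`
generated by the vector field `F`: every `t ↦ φ t z` solves `x' = F x`, `x 0 = z` in `S`
(with a one-sided derivative at `t = 0`), and it is the only solution in `S`. -/
structure GeneratesFlowOn {n : ℕ} (F : (Fin n → ℂ) → (Fin n → ℂ)) (S : Set (Fin n → ℂ))
    (φ : ℝ → (Fin n → ℂ) → (Fin n → ℂ)) : Prop where
  mapsTo : ∀ t : ℝ, 0 ≤ t → MapsTo (φ t) S S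
  zero : ∀ z ∈ S, φ 0 z = z
  add : ∀ t s : ℝ, 0 ≤ t → 0 ≤ s → ∀ z ∈ S, φ (t + s) z = φ t (φ s z)
  continuousOn : ContinuousOn (fun p : ℝ × (Fin n → ℂ) => φ p.1 p.2) (Ici 0 ×ˢ S)
  solves : ∀ z ∈ S, ∀ t : ℝ, 0 ≤ t →
    HasDerivWithinAt (fun s => φ s z) (F (φ t z)) (Ici 0) t
  unique : ∀ z ∈ S, ∀ (T : ℝ) (γ : ℝ → (Fin n → ℂ)), MapsTo γ (Icc 0 T) S → γ 0 = z →
    (∀ t ∈ Icc 0 T, HasDerivWithinAt γ (F (γ t)) (Icc 0 T) t) →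
    EqOn γ (fun t => φ t z) (Icc 0 T)

/-- Holomorphic flow: `F` is holomorphic on the open polydisc, continuous on the polydisc together
with the torus, and generates there the flow `φ`, which for each `t ≥ 0` maps the open polydisc
into itself holomorphically. -/
structure HolomorphicFlowAssumption {n : ℕ} (F : (Fin n → ℂ) → (Fin n → ℂ))
    (φ : ℝ → (Fin n → ℂ) → (Fin n → ℂ)) : Prop where
  holomorphic : DifferentiableOn ℂ F (openPolydisc (Fin n))
  continuous : ContinuousOn F (openPolydisc (Fin n) ∪ unitTorus (Fin n))
  generates : GeneratesFlowOn F (openPolydisc (Fin n) ∪ unitTorus (Fin n)) φ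
  flow_mapsTo : ∀ t : ℝ, 0 ≤ t → MapsTo (φ t) (openPolydisc (Fin n)) (openPolydisc (Fin n))
  flow_holomorphic : ∀ t : ℝ, 0 ≤ t → DifferentiableOn ℂ (φ t) (openPolydisc (Fin n))

/-- Forward invariance: for each `t > 0` the torus is mapped into a polydisc of radius `R < 1`. -/
def ForwardInvarianceAssumption {n : ℕ} (φ : ℝ → (Fin n → ℂ) → (Fin n → ℂ)) : Prop :=
  ∀ t : ℝ, 0 < t → ∃ R ∈ Ioo (0 : ℝ) 1, ∀ z ∈ unitTorus (Fin n), ∀ j, φ t z j ∈ Metric.ball 0 R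

open Filter Topology Metric
open scoped NNReal RealInnerProductSpace ComplexConjugate

/-!
Where `|z_j| = 1`, the inequality for `Re ((1 - conj z_j * u_j) * G_j)` says that `F_j` points
strictly into the disc. Hence every solution is pushed into the interior, to depth at least
`κ * t / (1 + t)` after time `t`, whether or not it starts on the boundary.

The field is only continuous up to the boundary, so uniqueness there is the crux. On a ball of
radius `ρ` the field oscillates by `o(1)`, and Cauchy's estimate bounds its Lipschitz constant at
depth `ρ` by `o(1 / ρ)`. Along two solutions this is at most `1 / (4 * t) + C`, and a Grönwall
inequality of Nagumo type then makes the distance of two solutions small, uniformly in the initial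
states. This gives uniqueness and continuous dependence up to the boundary.

Slightly smaller polydiscs are invariant and `F` is Lipschitz on them, which gives solutions from
interior points; solutions from boundary points are limits of these. The flow is holomorphic as the
uniform limit of Euler iterates, which for short steps also preserve the smaller polydiscs.
-/

/-! ### Cauchy estimates -/

section HolomorphicMaps

variable {E G : Type*} [NormedAddCommGroup E] [NormedSpace ℂ E] [NormedAddCommGroup G]
  [NormedSpace ℂ G]

theorem uniformCauchySeqOn_fderiv {α : Type*} {l : Filter α} {f : α → E → G} {x : E} {ρ : ℝ}
    (hρ : 0 < ρ) (h : UniformCauchySeqOn f l (ball x ρ))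
    (hf : ∀ᶠ a in l, DifferentiableOn ℂ (f a) (ball x ρ)) :
    UniformCauchySeqOn (fun a => fderiv ℂ (f a)) l (ball x (ρ / 2)) := by
  intro s hs
  obtain ⟨ε, hε, hεs⟩ := mem_uniformity_dist.1 hs
  filter_upwards [h _ (dist_mem_uniformity (by positivity : 0 < ε * ρ / 8)), hf.prod_mk hf]
    with p hp ⟨hf₁, hf₂⟩ y hy
  have hyρ : y ∈ ball x ρ := ball_subset_ball (by linarith) hy
  have hsub : ball y (ρ / 2) ⊆ ball x ρ := ball_subset_ball' (by rw [mem_ball] at hy; linarith)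
  have hdiff {g : E → G} (hg : DifferentiableOn ℂ g (ball x ρ)) : DifferentiableAt ℂ g y :=
    hg.differentiableAt (isOpen_ball.mem_nhds hyρ)
  have hmaps : MapsTo (f p.1 - f p.2) (ball y (ρ / 2))
      (closedBall ((f p.1 - f p.2) y) (ε * ρ / 4)) := fun w hw => by
    have hw' := hp w (hsub hw)
    have hy' := hp y hyρ
    simp only [dist_eq_norm] at hw' hy'
    rw [mem_closedBall, dist_eq_norm, Pi.sub_apply, Pi.sub_apply]
    linarith [norm_sub_le (f p.1 w - f p.2 w) (f p.1 y - f p.2 y)]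
  apply hεs
  calc dist (fderiv ℂ (f p.1) y) (fderiv ℂ (f p.2) y)
      = ‖fderiv ℂ (f p.1 - f p.2) y‖ := by
        rw [fderiv_sub (hdiff hf₁) (hdiff hf₂), dist_eq_norm]
    _ ≤ ε * ρ / 4 / (ρ / 2) :=
        Complex.norm_fderiv_le_div_of_mapsTo_ball ((hf₁.sub hf₂).mono hsub) hmaps (by positivity)
    _ = ε / 2 := by field_simp; norm_num
    _ < ε := half_lt_self hε

theorem differentiableOn_of_tendstoUniformlyOn [CompleteSpace G] {α : Type*} {l : Filter α}
    [l.NeBot] {f : α → E → G} {g : E → G} {U : Set E} (hU : IsOpen U)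
    (h : TendstoUniformlyOn f g l U) (hf : ∀ᶠ a in l, DifferentiableOn ℂ (f a) U) :
    DifferentiableOn ℂ g U := by
  intro x hx
  obtain ⟨ρ, hρ, hρU⟩ := Metric.isOpen_iff.1 hU x hx
  have hcauchy : UniformCauchySeqOn (fun a => fderiv ℂ (f a)) l (ball x (ρ / 2)) :=
    uniformCauchySeqOn_fderiv hρ (h.mono hρU).uniformCauchySeqOn
      (hf.mono fun _ ha => ha.mono hρU)
  choose! g' hg' using fun y hy => CompleteSpace.complete (hcauchy.cauchy_map (x := y) hy)
  have hball : ball x (ρ / 2) ∈ 𝓝 x := ball_mem_nhds x (half_pos hρ)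
  refine (hasFDerivAt_of_tendstoUniformlyOnFilter (f := f)
    ((hcauchy.tendstoUniformlyOn_of_tendsto hg').tendstoUniformlyOnFilter.mono_right
      (le_principal_iff.2 hball)) ?_ ?_).differentiableAt.differentiableWithinAt
  · filter_upwards [hf.prod_mk (hU.mem_nhds hx)] with p hp
    exact (hp.1.differentiableAt (hU.mem_nhds hp.2)).hasFDerivAt
  · filter_upwards [hU.mem_nhds hx] with y hy using h.tendsto_at hy

/-- Cauchy's estimate on balls of radius `ρ`, where `F` oscillates little by uniform continuity,
makes the Lipschitz constant at depth `ρ` as small a multiple of `1 / ρ` as desired. -/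
theorem exists_norm_sub_le_of_uniformContinuousOn {F : E → G} {x : E} {R : ℝ}
    (hF : DifferentiableOn ℂ F (ball x R)) (hF' : UniformContinuousOn F (ball x R))
    {ε : ℝ} (hε : 0 < ε) :
    ∃ C, 0 ≤ C ∧ ∀ ρ, 0 < ρ → ∀ z ∈ closedBall x (R - ρ), ∀ w ∈ closedBall x (R - ρ),
      ‖F z - F w‖ ≤ (ε / ρ + C) * ‖z - w‖ := by
  obtain ⟨δ, hδ, hunif⟩ := Metric.uniformContinuousOn_iff.1 hF' ε hε
  refine ⟨ε / δ, by positivity, fun ρ hρ z hz w hw => ?_⟩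
  have hsub : closedBall x (R - ρ) ⊆ ball x R := closedBall_subset_ball (by linarith)
  refine (convex_closedBall x (R - ρ)).norm_image_sub_le_of_norm_fderiv_le (𝕜 := ℂ)
    (fun y hy => hF.differentiableAt (isOpen_ball.mem_nhds (hsub hy))) (fun y hy => ?_) hw hz
  have hball : ball y (min ρ δ) ⊆ ball x R := ball_subset_ball' <| by
    rw [mem_closedBall] at hy
    linarith [min_le_left ρ δ]
  have hmaps : MapsTo F (ball y (min ρ δ)) (closedBall (F y) ε) := fun v hv =>
    (hunif v (hball hv) y (hsub hy) ((mem_ball.1 hv).trans_le (min_le_right _ _))).le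
  calc ‖fderiv ℂ F y‖ ≤ ε / min ρ δ :=
        Complex.norm_fderiv_le_div_of_mapsTo_ball (hF.mono hball) hmaps (lt_min hρ hδ)
    _ ≤ ε / ρ + ε / δ := by
        rcases min_choice ρ δ with h | h <;> rw [h]
        · linarith [div_pos hε hδ]
        · linarith [div_pos hε hρ]

theorem exists_lipschitzOnWith_closedBall {F : E → G} {x : E} {r R : ℝ}
    (hF : DifferentiableOn ℂ F (ball x R)) (hF' : UniformContinuousOn F (ball x R)) (hr : r < R) :
    ∃ L : ℝ≥0, LipschitzOnWith L F (closedBall x r) := by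
  obtain ⟨C, -, hC⟩ := exists_norm_sub_le_of_uniformContinuousOn hF hF' one_pos
  refine ⟨_, LipschitzOnWith.of_dist_le' (K := 1 / (R - r) + C) fun z hz w hw => ?_⟩
  simpa only [dist_eq_norm] using
    hC (R - r) (sub_pos.2 hr) z (by simpa using hz) w (by simpa using hw)

end HolomorphicMaps

/-! ### A Grönwall inequality with a singular rate -/

/-- The solution of `y' = (1 / (2 * (t + η)) + C) * y`, `y 0 = A * η`: the majorant of a function
of initial size at most `η` whose growth rate is `O(1 / t)` with a small constant. -/
noncomputable def singularGronwallBound (A C η t : ℝ) : ℝ := A * √(η * (t + η)) * Real.exp (C * t)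

section SingularGronwall

theorem hasDerivAt_singularGronwallBound (A C : ℝ) {η t : ℝ} (hη : 0 < η) (ht : 0 ≤ t) :
    HasDerivAt (singularGronwallBound A C η)
      ((1 / (2 * (t + η)) + C) * singularGronwallBound A C η t) t := by
  have hpos : 0 < η * (t + η) := by positivity
  have hlin : HasDerivAt (fun s : ℝ => η * (s + η)) η t := by
    simpa using ((hasDerivAt_id t).add_const η).const_mul η
  have hexp : HasDerivAt (fun s : ℝ => Real.exp (C * s)) (Real.exp (C * t) * C) t := by
    simpa using ((hasDerivAt_id t).const_mul C).exp
  refine (((hlin.sqrt hpos.ne').const_mul A).mul hexp).congr_deriv ?_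
  have hsqrt : η / (2 * √(η * (t + η))) = √(η * (t + η)) * (1 / (2 * (t + η))) := by
    have hsq : √(η * (t + η)) ^ 2 = η * (t + η) := Real.sq_sqrt hpos.le
    field_simp
    linarith
  rw [hsqrt, singularGronwallBound]
  ring

theorem mul_half_le_singularGronwallBound {A C η t : ℝ} (hA : 0 ≤ A) (hC : 0 ≤ C) (ht : 0 ≤ t)
    (htη : t ≤ η) : A * ((t + η) / 2) ≤ singularGronwallBound A C η t := by
  have hsqrt : (t + η) / 2 ≤ √(η * (t + η)) := Real.le_sqrt_of_sq_le (by nlinarith)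
  calc A * ((t + η) / 2) ≤ A * √(η * (t + η)) := mul_le_mul_of_nonneg_left hsqrt hA
    _ ≤ singularGronwallBound A C η t :=
        le_mul_of_one_le_right (by positivity) (Real.one_le_exp (by positivity))

theorem singularGronwallBound_mono {A C η : ℝ} (hA : 0 ≤ A) (hC : 0 ≤ C) (hη : 0 ≤ η) :
    Monotone (singularGronwallBound A C η) := fun s t hst => by
  unfold singularGronwallBound
  gcongr

theorem tendsto_singularGronwallBound_zero (A C t : ℝ) :
    Tendsto (fun η => singularGronwallBound A C η t) (𝓝 0) (𝓝 0) := by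
  have hcont : Continuous fun η => singularGronwallBound A C η t := by
    unfold singularGronwallBound
    fun_prop
  simpa [singularGronwallBound] using hcont.tendsto 0

/-- A Grönwall inequality for the rate `1 / (4 * t) + C`, which is not integrable at `0`; the bound
on `‖f' t‖` takes over for `t ≤ η`. -/
theorem norm_le_singularGronwallBound {E : Type*} [NormedAddCommGroup E] [NormedSpace ℝ E]
    {f f' : ℝ → E} {T M C η : ℝ} (hC : 0 ≤ C) (hM : 0 ≤ M) (hη : 0 < η)
    (hf : ContinuousOn f (Icc 0 T)) (hf' : ∀ t ∈ Ico 0 T, HasDerivWithinAt f (f' t) (Ici t) t)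
    (h0 : ‖f 0‖ ≤ η) (hbound : ∀ t ∈ Ico 0 T, ‖f' t‖ ≤ M)
    (hrate : ∀ t ∈ Ioo 0 T, ‖f' t‖ ≤ (1 / (4 * t) + C) * ‖f t‖) :
    ∀ t ∈ Icc 0 T, ‖f t‖ ≤ singularGronwallBound (4 * M + 1) C η t := by
  refine image_norm_le_of_norm_deriv_right_lt_deriv_boundary' hf hf' ?_
    (fun t ht => (hasDerivAt_singularGronwallBound _ C hη ht.1).continuousAt.continuousWithinAt)
    (fun t ht => (hasDerivAt_singularGronwallBound _ C hη ht.1).hasDerivWithinAt)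
    fun t ht heq => ?_
  · have : singularGronwallBound (4 * M + 1) C η 0 = (4 * M + 1) * η := by
      simp [singularGronwallBound, Real.sqrt_mul_self hη.le]
    nlinarith
  · have ht0 : 0 ≤ t := ht.1
    rcases le_or_gt t η with htη | hηt
    · have hb := mul_half_le_singularGronwallBound (A := 4 * M + 1) (by positivity) hC ht0 htη
      set b := singularGronwallBound (4 * M + 1) C η t
      have hb0 : 0 ≤ b := le_trans (by positivity) hb
      calc ‖f' t‖ ≤ M := hbound t ht
        _ < (4 * M + 1) / 4 := by linarith
        _ = 1 / (2 * (t + η)) * ((4 * M + 1) * ((t + η) / 2)) := by field_simp; norm_num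
        _ ≤ 1 / (2 * (t + η)) * b := by gcongr
        _ ≤ (1 / (2 * (t + η)) + C) * b := by
            rw [add_mul]
            exact le_add_of_nonneg_right (mul_nonneg hC hb0)
    · have ht_pos : 0 < t := hη.trans hηt
      have hrate' := hrate t ⟨ht_pos, ht.2⟩
      rw [heq] at hrate'
      refine hrate'.trans_lt (mul_lt_mul_of_pos_right ?_ ?_)
      · have : 1 / (4 * t) < 1 / (2 * (t + η)) :=
          one_div_lt_one_div_of_lt (by positivity) (by linarith)
        linarith
      · unfold singularGronwallBound
        positivity

end SingularGronwall

/-! ### Solutions of autonomous equations -/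

/-- `γ` solves the autonomous equation `x' = F x` on `[0, T]`, with values in `S`. -/
structure IsSolutionIn {E : Type*} [NormedAddCommGroup E] [NormedSpace ℝ E] (F : E → E)
    (S : Set E) (T : ℝ) (γ : ℝ → E) : Prop where
  mapsTo : MapsTo γ (Icc 0 T) S
  isIntegralCurveOn : IsIntegralCurveOn γ (fun _ => F) (Icc 0 T)

namespace IsSolutionIn

variable {E : Type*} [NormedAddCommGroup E] [NormedSpace ℝ E] {F : E → E} {S : Set E}
  {T T' M t : ℝ} {γ γ' : ℝ → E}

theorem continuousOn (h : IsSolutionIn F S T γ) : ContinuousOn γ (Icc 0 T) :=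
  h.isIntegralCurveOn.continuousOn

theorem hasDerivWithinAt_Ici (h : IsSolutionIn F S T γ) (ht : t ∈ Ico 0 T) :
    HasDerivWithinAt γ (F (γ t)) (Ici t) t :=
  (h.isIntegralCurveOn t (Ico_subset_Icc_self ht)).mono_of_mem_nhdsWithin
    (Icc_mem_nhdsGE_of_mem ht)

theorem mono (h : IsSolutionIn F S T γ) (hT : T' ≤ T) : IsSolutionIn F S T' γ :=
  ⟨h.mapsTo.mono_left (Icc_subset_Icc_right hT),
    h.isIntegralCurveOn.mono (Icc_subset_Icc_right hT)⟩

theorem mono_set {S' : Set E} (h : IsSolutionIn F S T γ) (hS : S ⊆ S') : IsSolutionIn F S' T γ :=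
  ⟨h.mapsTo.mono_right hS, h.isIntegralCurveOn⟩

theorem congr (h : IsSolutionIn F S T γ) (hγ : EqOn γ' γ (Icc 0 T)) : IsSolutionIn F S T γ' :=
  ⟨h.mapsTo.congr hγ.symm, fun t ht => by
    simpa only [hγ ht] using (h.isIntegralCurveOn t ht).congr hγ (hγ ht)⟩

theorem comp_add {s : ℝ} (h : IsSolutionIn F S T γ) (hs : 0 ≤ s) (hT : T' + s ≤ T) :
    IsSolutionIn F S T' (fun t => γ (t + s)) := by
  have hmaps : MapsTo (· + s) (Icc 0 T') (Icc 0 T) := fun t ht =>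
    ⟨by linarith [ht.1], by linarith [ht.2]⟩
  refine ⟨h.mapsTo.comp hmaps, fun t ht => ?_⟩
  simpa [Function.comp_def] using (h.isIntegralCurveOn _ (hmaps ht)).scomp t
    ((hasDerivWithinAt_id t (Icc 0 T')).add_const s) hmaps

theorem norm_sub_le (h : IsSolutionIn F S T γ) (hM : ∀ z ∈ S, ‖F z‖ ≤ M) {s : ℝ}
    (hs : s ∈ Icc 0 T) (ht : t ∈ Icc 0 T) : ‖γ t - γ s‖ ≤ M * ‖t - s‖ :=
  (convex_Icc 0 T).norm_image_sub_le_of_norm_hasDerivWithin_le h.isIntegralCurveOn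
    (fun _ hr => hM _ (h.mapsTo hr)) hs ht

section CompleteSpace

variable [CompleteSpace E]

theorem picard_eq (h : IsSolutionIn F S T γ) (hF : ContinuousOn F S) (ht : t ∈ Icc 0 T) :
    ODE.picard (fun _ => F) 0 (γ 0) γ t = γ t := by
  have h' := h.mono ht.2
  refine ODE.picard_eq_of_hasDerivAt (u := S)
    (hF.comp continuousOn_snd fun p hp => hp.2) ?_ ?_ <;> rw [uIcc_of_le ht.1]
  exacts [h'.isIntegralCurveOn, h'.mapsTo]

theorem of_picard_eq (hF : ContinuousOn F S) (hγ : ContinuousOn γ (Icc 0 T))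
    (hmaps : MapsTo γ (Icc 0 T) S)
    (h : EqOn γ (ODE.picard (fun _ => F) 0 (γ 0) γ) (Icc 0 T)) : IsSolutionIn F S T γ :=
  ⟨hmaps, fun _ ht => (ODE.hasDerivWithinAt_picard_Icc (f := fun _ => F) (u := S)
    ⟨le_rfl, ht.1.trans ht.2⟩ (hF.comp continuousOn_snd fun _ hp => hp.2) hγ hmaps (γ 0) ht).congr
      h (h ht)⟩

theorem of_tendsto {γ : ℕ → ℝ → E} (hS : IsClosed S) (hF : ContinuousOn F S)
    (hM : ∀ z ∈ S, ‖F z‖ ≤ M) (h : ∀ k, IsSolutionIn F S T (γ k))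
    (hγ : ∀ t ∈ Icc 0 T, Tendsto (fun k => γ k t) atTop (𝓝 (γ' t))) : IsSolutionIn F S T γ' := by
  have hmaps : MapsTo γ' (Icc 0 T) S := fun t ht =>
    hS.mem_of_tendsto (hγ t ht) (Eventually.of_forall fun k => (h k).mapsTo ht)
  have hcont : ContinuousOn γ' (Icc 0 T) := by
    refine (LipschitzOnWith.of_dist_le' (K := M) fun t ht s hs => ?_).continuousOn
    simpa only [dist_eq_norm] using le_of_tendsto ((hγ t ht).sub (hγ s hs)).norm
      (Eventually.of_forall fun k => (h k).norm_sub_le hM hs ht)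
  refine of_picard_eq hF hcont hmaps fun t ht => tendsto_nhds_unique (hγ t ht) ?_
  have hsub : uIoc 0 t ⊆ Icc 0 T := by
    rw [uIoc_of_le ht.1]
    exact Ioc_subset_Icc_self.trans (Icc_subset_Icc_right ht.2)
  refine Tendsto.congr (fun k => (h k).picard_eq hF ht) <|
    (hγ 0 ⟨le_rfl, ht.1.trans ht.2⟩).add
      (intervalIntegral.tendsto_integral_filter_of_dominated_convergence (fun _ => M) ?_ ?_
        intervalIntegrable_const (MeasureTheory.ae_of_all _ fun s hs => ?_))
  · exact Eventually.of_forall fun k =>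
      (hF.comp ((h k).continuousOn.mono hsub) ((h k).mapsTo.mono_left hsub)).aestronglyMeasurable
        measurableSet_uIoc
  · exact Eventually.of_forall fun k => MeasureTheory.ae_of_all _ fun s hs =>
      hM _ ((h k).mapsTo (hsub hs))
  · exact (hF _ (hmaps (hsub hs))).tendsto.comp <| tendsto_nhdsWithin_iff.2
      ⟨hγ s (hsub hs), Eventually.of_forall fun k => (h k).mapsTo (hsub hs)⟩

end CompleteSpace

end IsSolutionIn

theorem exists_isSolutionIn_univ_of_lipschitzWith {E : Type*} [NormedAddCommGroup E]
    [NormedSpace ℝ E] [CompleteSpace E] {F : E → E} {K M : ℝ≥0} (hF : LipschitzWith K F)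
    (hM : ∀ z, ‖F z‖ ≤ M) {T : ℝ} (hT : 0 ≤ T) (z : E) :
    ∃ γ, γ 0 = z ∧ IsSolutionIn F univ T γ := by
  have hpicard : IsPicardLindelof (fun _ => F) (⟨0, le_rfl, hT⟩ : Icc (0 : ℝ) T) z
      (M * T.toNNReal) 0 M K :=
    ⟨fun _ _ => hF.lipschitzOnWith, fun _ _ => continuousOn_const, fun _ _ x _ => hM x,
      by simp [hT]⟩
  obtain ⟨γ, hγ0, hγ⟩ := hpicard.exists_eq_forall_mem_Icc_hasDerivWithinAt₀
  exact ⟨γ, hγ0, mapsTo_univ _ _, hγ⟩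

/-! ### Invariant polydiscs -/

/-- The radial retraction onto the closed ball of radius `r` about `0`. -/
noncomputable def ballRetraction {V : Type*} [NormedAddCommGroup V] [NormedSpace ℝ V] (r : ℝ)
    (v : V) : V := (r / max r ‖v‖) • v

section BallRetraction

variable {V : Type*} [NormedAddCommGroup V] [NormedSpace ℝ V] {r : ℝ}

theorem ballRetraction_of_norm_le (hr : 0 < r) {v : V} (hv : ‖v‖ ≤ r) :
    ballRetraction r v = v := by
  rw [ballRetraction, max_eq_left hv, div_self hr.ne', one_smul]

theorem norm_ballRetraction_le (hr : 0 < r) (v : V) : ‖ballRetraction r v‖ ≤ r := by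
  have hmax : 0 < max r ‖v‖ := lt_max_of_lt_left hr
  rw [ballRetraction, norm_smul, Real.norm_of_nonneg (by positivity), div_mul_eq_mul_div,
    div_le_iff₀ hmax]
  exact mul_le_mul_of_nonneg_left (le_max_right _ _) hr.le

theorem lipschitzWith_ballRetraction (hr : 0 < r) :
    LipschitzWith 2 (ballRetraction r : V → V) := by
  refine LipschitzWith.of_dist_le_mul fun v w => ?_
  have hv : 0 < max r ‖v‖ := lt_max_of_lt_left hr
  have hw : 0 < max r ‖w‖ := lt_max_of_lt_left hr
  have hrv : r / max r ‖v‖ ≤ 1 := (div_le_one hv).2 (le_max_left _ _)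
  have hmax : |max r ‖w‖ - max r ‖v‖| ≤ ‖v - w‖ := by
    calc |max r ‖w‖ - max r ‖v‖| ≤ |‖w‖ - ‖v‖| := by
          simpa only [max_comm r] using abs_max_sub_max_le_abs ‖w‖ ‖v‖ r
      _ ≤ ‖v - w‖ := norm_sub_rev v w ▸ abs_norm_sub_norm_le w v
  have hdirection : ‖(r / max r ‖v‖) • (v - w)‖ ≤ ‖v - w‖ := by
    rw [norm_smul, Real.norm_of_nonneg (by positivity)]
    exact mul_le_of_le_one_left (norm_nonneg _) hrv
  have hscale : ‖(r / max r ‖v‖ - r / max r ‖w‖) • w‖ ≤ ‖v - w‖ := by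
    calc ‖(r / max r ‖v‖ - r / max r ‖w‖) • w‖
        = r / max r ‖v‖ * (|max r ‖w‖ - max r ‖v‖| * (‖w‖ / max r ‖w‖)) := by
          rw [show r / max r ‖v‖ - r / max r ‖w‖ =
              r / max r ‖v‖ * ((max r ‖w‖ - max r ‖v‖) / max r ‖w‖) by field_simp,
            norm_smul, Real.norm_eq_abs, abs_mul,
            abs_of_pos (div_pos hr hv), abs_div, abs_of_pos hw]
          ring
      _ ≤ 1 * (‖v - w‖ * 1) := by
          gcongr
          exact (div_le_one hw).2 (le_max_right _ _)
      _ = ‖v - w‖ := by ring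
  calc dist (ballRetraction r v) (ballRetraction r w)
      = ‖(r / max r ‖v‖) • (v - w) + (r / max r ‖v‖ - r / max r ‖w‖) • w‖ := by
        rw [dist_eq_norm, ballRetraction, ballRetraction, smul_sub, sub_smul, sub_add_sub_cancel]
    _ ≤ (2 : ℝ≥0) * dist v w := by
        rw [dist_eq_norm, NNReal.coe_ofNat, two_mul]
        exact (norm_add_le _ _).trans (add_le_add hdirection hscale)

end BallRetraction

section InwardBound

variable {ι V : Type*} [Fintype ι] [NormedAddCommGroup V] [InnerProductSpace ℝ V]
  {F : (ι → V) → ι → V} {S : Set (ι → V)} {T t r : ℝ} {γ : ℝ → ι → V} {j : ι}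

namespace IsSolutionIn

theorem norm_sq_apply_le (h : IsSolutionIn F S T γ) {b b' : ℝ → ℝ} (h0 : ‖γ 0 j‖ ^ 2 ≤ b 0)
    (hb : ∀ s ∈ Icc 0 T, HasDerivAt b (b' s) s)
    (hlt : ∀ s ∈ Ico 0 T, ‖γ s j‖ ^ 2 = b s → 2 * ⟪γ s j, F (γ s) j⟫ < b' s) (ht : t ∈ Icc 0 T) :
    ‖γ t j‖ ^ 2 ≤ b t :=
  image_le_of_deriv_right_lt_deriv_boundary' (f := fun s => ‖γ s j‖ ^ 2)
    ((continuousOn_pi.1 h.continuousOn j).norm.pow 2)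
    (fun _ hs => (hasDerivWithinAt_pi.1 (h.hasDerivWithinAt_Ici hs) j).norm_sq) h0
    (fun s hs => (hb s hs).continuousAt.continuousWithinAt)
    (fun s hs => (hb s (Ico_subset_Icc_self hs)).hasDerivWithinAt) hlt ht

theorem norm_apply_le (h : IsSolutionIn F S T γ) (hr : 0 ≤ r) (h0 : ‖γ 0 j‖ ≤ r)
    (hneg : ∀ x ∈ S, ‖x j‖ = r → ⟪x j, F x j⟫ < 0) (ht : t ∈ Icc 0 T) : ‖γ t j‖ ≤ r := by
  refine le_of_sq_le_sq (h.norm_sq_apply_le (b := fun _ => r ^ 2) (b' := fun _ => 0)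
    (pow_le_pow_left₀ (norm_nonneg _) h0 2) (fun s _ => hasDerivAt_const s _)
    (fun s hs heq => ?_) ht) hr
  linarith [hneg _ (h.mapsTo (Ico_subset_Icc_self hs)) ((sq_eq_sq₀ (norm_nonneg _) hr).1 heq)]

end IsSolutionIn

/-- On the closed unit polydisc, the radial component of each coordinate of `F` is at most `-c` on
the boundary, up to an error proportional to the distance from it. -/
def InwardBound (F : (ι → V) → ι → V) (c B : ℝ) : Prop :=
  ∀ z ∈ closedBall (0 : ι → V) 1, ∀ j, ⟪z j, F z j⟫ ≤ -c + B * (1 - ‖z j‖ ^ 2)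

namespace InwardBound

variable {c B : ℝ}

theorem inner_neg (hF : InwardBound F c B) (hr : B * (1 - r ^ 2) < c) :
    ∀ z ∈ closedBall (0 : ι → V) 1, ∀ j, ‖z j‖ = r → ⟪z j, F z j⟫ < 0 := fun z hz j hzj => by
  have := hF z hz j
  rw [hzj] at this
  linarith

theorem norm_sq_solution_apply_le (hF : InwardBound F c B) (hB : 0 ≤ B) {k : ℝ} (hk : 0 ≤ k)
    (hkc : k * (1 + 2 * B) < 2 * c) (h : IsSolutionIn F (closedBall 0 1) T γ)
    (ht : t ∈ Icc 0 T) (j : ι) : ‖γ t j‖ ^ 2 ≤ 1 - k * (t / (1 + t)) := by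
  refine h.norm_sq_apply_le (b := fun s => 1 - k * (s / (1 + s)))
    (b' := fun s => -(k / (1 + s) ^ 2)) ?_ (fun s hs => ?_) (fun s hs heq => ?_) ht
  · have h0 := h.mapsTo ⟨le_rfl, ht.1.trans ht.2⟩
    simpa using (norm_le_pi_norm (γ 0) j).trans (mem_closedBall_zero_iff.1 h0)
  · have hs0 : 1 + s ≠ 0 := by linarith [hs.1]
    refine ((((hasDerivAt_id s).div ((hasDerivAt_id s).const_add 1) hs0).const_mul k).const_sub
      1).congr_deriv ?_
    simp only [id]
    field_simp
    ring
  · have hs0 : 0 ≤ s := hs.1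
    have hle := hF (γ s) (h.mapsTo (Ico_subset_Icc_self hs)) j
    rw [heq] at hle
    have hfrac : B * (k * (s / (1 + s))) ≤ B * k := by
      gcongr
      exact mul_le_of_le_one_right hk ((div_le_one (by positivity)).2 (by linarith))
    have hsq : k / (1 + s) ^ 2 ≤ k := div_le_self hk (one_le_pow₀ (by linarith))
    linarith

theorem exists_norm_solution_le (hF : InwardBound F c B) (hc : 0 < c) (hB : 0 ≤ B) :
    ∃ κ ∈ Ioc (0 : ℝ) 1, ∀ T γ, IsSolutionIn F (closedBall 0 1) T γ →
      ∀ t ∈ Icc 0 T, ‖γ t‖ ≤ 1 - κ * (t / (1 + t)) := by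
  obtain ⟨k, hk0, hk1, hk⟩ : ∃ k, 0 < k ∧ k ≤ 1 ∧ k * (1 + 2 * B) < 2 * c := by
    refine ⟨min 1 (c / (1 + 2 * B)), by positivity, min_le_left _ _, ?_⟩
    linarith [(le_div_iff₀ (by positivity)).1 (min_le_right 1 (c / (1 + 2 * B)))]
  refine ⟨k / 2, ⟨by positivity, by linarith⟩, fun T γ h t ht => ?_⟩
  have ht0 : 0 ≤ t := ht.1
  have hfrac1 : t / (1 + t) ≤ 1 := (div_le_one (by positivity)).2 (by linarith)
  have hle : 0 ≤ 1 - k / 2 * (t / (1 + t)) := by nlinarith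
  refine (pi_norm_le_iff_of_nonneg hle).2 fun j => le_of_sq_le_sq ?_ hle
  nlinarith [hF.norm_sq_solution_apply_le hB hk0.le hk h ht j, sq_nonneg (k * (t / (1 + t)))]

theorem mapsTo_closedBall (hF : InwardBound F c B) (hr : 0 ≤ r) (hrc : B * (1 - r ^ 2) < c)
    (h : IsSolutionIn F (closedBall 0 1) T γ) (h0 : γ 0 ∈ closedBall 0 r) :
    MapsTo γ (Icc 0 T) (closedBall 0 r) := fun _ ht =>
  mem_closedBall_zero_iff.2 <| (pi_norm_le_iff_of_nonneg hr).2 fun j =>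
    h.norm_apply_le hr ((norm_le_pi_norm _ j).trans (mem_closedBall_zero_iff.1 h0))
      (fun x hx => hF.inner_neg hrc x hx j) ht

theorem exists_isSolutionIn_closedBall [CompleteSpace V] (hF : InwardBound F c B) {L : ℝ≥0}
    (hL : LipschitzOnWith L F (closedBall 0 r)) (hr0 : 0 < r) (hr1 : r ≤ 1)
    (hrc : B * (1 - r ^ 2) < c) (hT : 0 ≤ T) {z : ι → V} (hz : z ∈ closedBall 0 r) :
    ∃ γ, γ 0 = z ∧ IsSolutionIn F (closedBall 0 r) T γ := by
  -- `F ∘ P` is globally Lipschitz, and its solutions never leave the ball, where it equals `F`.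
  set P : (ι → V) → ι → V := fun x j => ballRetraction r (x j)
  have hPmem (x) : P x ∈ closedBall 0 r := mem_closedBall_zero_iff.2 <|
    (pi_norm_le_iff_of_nonneg hr0.le).2 fun j => norm_ballRetraction_le hr0 _
  have hPlip : LipschitzWith 2 P := LipschitzWith.of_dist_le_mul fun x y =>
    (dist_pi_le_iff (by positivity)).2 fun j =>
      ((lipschitzWith_ballRetraction hr0).dist_le_mul _ _).trans <| by
        gcongr
        exact dist_le_pi_dist x y j
  have hPfix {x : ι → V} (hx : ∀ j, ‖x j‖ ≤ r) : P x = x :=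
    funext fun j => ballRetraction_of_norm_le hr0 (hx j)
  have hFPlip : LipschitzWith (L * 2) (F ∘ P) :=
    lipschitzOnWith_univ.1 (hL.comp (lipschitzOnWith_univ.2 hPlip) fun x _ => hPmem x)
  have hFPbound (x) : ‖(F ∘ P) x‖ ≤ (‖F 0‖₊ + L * r.toNNReal : ℝ≥0) := by
    have hdist := hL.dist_le_mul _ (hPmem x) 0 (mem_closedBall_self hr0.le)
    have hle := mul_le_mul_of_nonneg_left (mem_closedBall.1 (hPmem x)) L.coe_nonneg
    rw [dist_eq_norm] at hdist
    push_cast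
    rw [Real.coe_toNNReal _ hr0.le, Function.comp_apply]
    linarith [norm_le_norm_add_norm_sub' (F (P x)) (F 0)]
  obtain ⟨γ, rfl, hγ⟩ := exists_isSolutionIn_univ_of_lipschitzWith hFPlip hFPbound hT z
  have hγr (t) (ht : t ∈ Icc 0 T) (j) : ‖γ t j‖ ≤ r := by
    refine hγ.norm_apply_le hr0.le ((norm_le_pi_norm _ j).trans (mem_closedBall_zero_iff.1 hz))
      (fun x _ hxj => ?_) ht
    have hPx : P x j = x j := ballRetraction_of_norm_le hr0 hxj.le
    simpa only [hPx, Function.comp_apply] using hF.inner_neg hrc (P x)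
      (closedBall_subset_closedBall hr1 (hPmem x)) j (hPx.symm ▸ hxj)
  refine ⟨γ, rfl, fun t ht => hPfix (hγr t ht) ▸ hPmem (γ t), fun t ht => ?_⟩
  simpa only [Function.comp_apply, hPfix (hγr t ht)] using hγ.isIntegralCurveOn t ht

end InwardBound

end InwardBound

/-! ### Euler approximation -/

/-- Each curve `t ↦ φ t z`, `z ∈ S`, solves `x' = F x`, `x 0 = z`, in `S` for all `t ≥ 0`. -/
structure IsSolutionFamily {E : Type*} [NormedAddCommGroup E] [NormedSpace ℝ E] (F : E → E)
    (S : Set E) (φ : ℝ → E → E) : Prop where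
  zero : ∀ z ∈ S, φ 0 z = z
  isSolutionIn : ∀ z ∈ S, ∀ T, IsSolutionIn F S T fun t => φ t z

/-- One step of length `h` of the explicit Euler scheme for `x' = F x`. -/
noncomputable def eulerStep {E : Type*} [NormedAddCommGroup E] [NormedSpace ℝ E] (F : E → E)
    (h : ℝ) (z : E) : E := z + h • F z

section Euler

variable {E : Type*} [NormedAddCommGroup E] [NormedSpace ℝ E] {F : E → E} {S : Set E}
  {L : ℝ≥0} {M h : ℝ}

theorem norm_eulerStep_sub_le (hL : LipschitzOnWith L F S) (hh : 0 ≤ h) {z w : E} (hz : z ∈ S)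
    (hw : w ∈ S) : ‖eulerStep F h z - eulerStep F h w‖ ≤ (1 + L * h) * ‖z - w‖ := by
  calc ‖eulerStep F h z - eulerStep F h w‖ = ‖(z - w) + h • (F z - F w)‖ := by
        rw [eulerStep, eulerStep, smul_sub, add_sub_add_comm]
    _ ≤ ‖z - w‖ + h * (L * ‖z - w‖) := by
        refine (norm_add_le _ _).trans ?_
        rw [norm_smul, Real.norm_of_nonneg hh]
        gcongr
        exact hL.norm_sub_le hz hw
    _ = (1 + L * h) * ‖z - w‖ := by ring

theorem IsSolutionIn.norm_sub_eulerStep_le {T a : ℝ} {γ : ℝ → E} (hγ : IsSolutionIn F S T γ)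
    (hL : LipschitzOnWith L F S) (hM : ∀ z ∈ S, ‖F z‖ ≤ M) (ha : 0 ≤ a) (hh : 0 ≤ h)
    (hT : a + h ≤ T) : ‖γ (a + h) - eulerStep F h (γ a)‖ ≤ L * M * h ^ 2 := by
  have hsub : Icc a (a + h) ⊆ Icc 0 T := Icc_subset_Icc ha hT
  have ha' : a ∈ Icc 0 T := hsub (left_mem_Icc.2 (le_add_of_nonneg_right hh))
  have hM0 : 0 ≤ M := (norm_nonneg _).trans (hM _ (hγ.mapsTo ha'))
  have hrate : ∀ s ∈ Ico a (a + h), ‖F (γ s) - F (γ a)‖ ≤ L * (M * h) := fun s hs => by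
    have hs' := hsub (Ico_subset_Icc_self hs)
    calc ‖F (γ s) - F (γ a)‖ ≤ L * ‖γ s - γ a‖ :=
          hL.norm_sub_le (hγ.mapsTo hs') (hγ.mapsTo ha')
      _ ≤ L * (M * ‖s - a‖) := by
          gcongr
          exact hγ.norm_sub_le hM ha' hs'
      _ ≤ L * (M * h) := by
          gcongr
          rw [Real.norm_of_nonneg (sub_nonneg.2 hs.1)]
          linarith [hs.2]
  have hdev := norm_image_sub_le_of_norm_deriv_le_segment' (f := fun s => γ s - s • F (γ a))
    (fun s hs => by
      simpa using ((hγ.isIntegralCurveOn s (hsub hs)).mono hsub).fun_sub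
        ((hasDerivWithinAt_id s _).smul_const (F (γ a))))
    hrate (a + h) (right_mem_Icc.2 (le_add_of_nonneg_right hh))
  calc ‖γ (a + h) - eulerStep F h (γ a)‖
      = ‖γ (a + h) - (a + h) • F (γ a) - (γ a - a • F (γ a))‖ := by
        rw [eulerStep, add_smul]
        congr 1
        abel
    _ ≤ L * (M * h) * (a + h - a) := hdev
    _ = L * M * h ^ 2 := by ring

namespace IsSolutionFamily

variable {φ : ℝ → E → E} {t : ℝ}

theorem norm_sub_eulerStep_iterate_le (hφ : IsSolutionFamily F S φ) (hL : LipschitzOnWith L F S)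
    (hM : ∀ z ∈ S, ‖F z‖ ≤ M) (hE : MapsTo (eulerStep F h) S S) (hh : 0 ≤ h) {z : E} (hz : z ∈ S)
    (m : ℕ) :
    ‖φ (m * h) z - (eulerStep F h)^[m] z‖ ≤ m * (L * M * h ^ 2) * Real.exp (m * (L * h)) := by
  have hM0 : 0 ≤ M := (norm_nonneg _).trans (hM z hz)
  have hstep (k : ℕ) (_ : 0 ≤ k) : ‖φ ((k + 1 : ℕ) * h) z - (eulerStep F h)^[k + 1] z‖ ≤
      (1 + L * h) * ‖φ (k * h) z - (eulerStep F h)^[k] z‖ + L * M * h ^ 2 := by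
    have hγ := hφ.isSolutionIn z hz (k * h + h)
    have hk : 0 ≤ k * h := by positivity
    have hconsistent := hγ.norm_sub_eulerStep_le hL hM hk hh le_rfl
    have hstable := norm_eulerStep_sub_le hL hh
      (hγ.mapsTo ⟨hk, le_add_of_nonneg_right hh⟩) (hE.iterate k hz)
    rw [Function.iterate_succ_apply', Nat.cast_add_one, add_one_mul]
    linarith [norm_sub_le_norm_sub_add_norm_sub (φ (k * h + h) z) (eulerStep F h (φ (k * h) z))
      (eulerStep F h ((eulerStep F h)^[k] z))]
  simpa [hφ.zero z hz] using
    discrete_gronwall (u := fun m : ℕ => ‖φ (m * h) z - (eulerStep F h)^[m] z‖)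
      (norm_nonneg _) hstep (fun _ _ => by positivity) (fun _ _ => by positivity) (Nat.zero_le m)

theorem tendstoUniformlyOn_eulerStep_iterate (hφ : IsSolutionFamily F S φ)
    (hL : LipschitzOnWith L F S) (hM : ∀ z ∈ S, ‖F z‖ ≤ M)
    (hE : ∀ᶠ h in 𝓝[≥] 0, MapsTo (eulerStep F h) S S) (ht : 0 ≤ t) :
    TendstoUniformlyOn (fun m : ℕ => (eulerStep F (t / m))^[m]) (φ t) atTop S := by
  have hstep : Tendsto (fun m : ℕ => t / m) atTop (𝓝 0) := tendsto_const_div_atTop_nhds_zero_nat t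
  have hstep' : Tendsto (fun m : ℕ => t / m) atTop (𝓝[≥] 0) :=
    tendsto_nhdsWithin_iff.2 ⟨hstep, Eventually.of_forall fun m => div_nonneg ht m.cast_nonneg⟩
  have herror : Tendsto (fun m : ℕ => t * (L * M * (t / m)) * Real.exp (L * t)) atTop (𝓝 0) := by
    simpa using ((hstep.const_mul (L * M)).const_mul t).mul_const (Real.exp (L * t))
  rw [Metric.tendstoUniformlyOn_iff]
  intro ε hε
  filter_upwards [herror.eventually (gt_mem_nhds hε), hstep'.eventually hE, eventually_gt_atTop 0]
    with m hmε hmE hm z hz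
  have hmt : m * (t / m) = t := mul_div_cancel₀ t (by positivity)
  calc dist (φ t z) ((eulerStep F (t / m))^[m] z)
      = ‖φ (m * (t / m)) z - (eulerStep F (t / m))^[m] z‖ := by
        rw [dist_eq_norm, hmt]
    _ ≤ m * (L * M * (t / m) ^ 2) * Real.exp (m * (L * (t / m))) :=
        hφ.norm_sub_eulerStep_iterate_le hL hM hmE (by positivity) hz m
    _ = m * (t / m) * (L * M * (t / m)) * Real.exp (L * (m * (t / m))) := by ring_nf
    _ < ε := by rwa [hmt]

theorem differentiableOn_interior [NormedSpace ℂ E] [SMulCommClass ℂ ℝ E] [CompleteSpace E]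
    (hφ : IsSolutionFamily F S φ) (hF : DifferentiableOn ℂ F S) (hL : LipschitzOnWith L F S)
    (hM : ∀ z ∈ S, ‖F z‖ ≤ M) (hE : ∀ᶠ h in 𝓝[≥] 0, MapsTo (eulerStep F h) S S) (ht : 0 ≤ t) :
    DifferentiableOn ℂ (φ t) (interior S) := by
  have hstep : Tendsto (fun m : ℕ => t / m) atTop (𝓝[≥] 0) :=
    tendsto_nhdsWithin_iff.2 ⟨tendsto_const_div_atTop_nhds_zero_nat t,
      Eventually.of_forall fun m => div_nonneg ht m.cast_nonneg⟩
  refine differentiableOn_of_tendstoUniformlyOn isOpen_interior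
    ((hφ.tendstoUniformlyOn_eulerStep_iterate hL hM hE ht).mono interior_subset) ?_
  filter_upwards [hstep.eventually hE] with m hm
  have hdiff : DifferentiableOn ℂ (eulerStep F (t / m)) S :=
    differentiableOn_id.add (hF.const_smul (t / m))
  exact (hdiff.iterate hm m).mono interior_subset

end IsSolutionFamily

end Euler

namespace InwardBound

variable {ι V : Type*} [Fintype ι] [NormedAddCommGroup V] [InnerProductSpace ℝ V]
  {F : (ι → V) → ι → V} {c B M r : ℝ}

theorem mapsTo_eulerStep (hF : InwardBound F c B) (hM : ∀ z ∈ closedBall 0 r, ‖F z‖ ≤ M)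
    (hr0 : 0 ≤ r) (hr1 : r ≤ 1) {h : ℝ} (hh : 0 ≤ h) (hB : h * (2 * B) ≤ 1)
    (hMc : h * M ^ 2 ≤ 2 * (c - B * (1 - r ^ 2))) :
    MapsTo (eulerStep F h) (closedBall 0 r) (closedBall 0 r) := fun z hz => by
  refine mem_closedBall_zero_iff.2 <| (pi_norm_le_iff_of_nonneg hr0).2 fun j =>
    le_of_sq_le_sq ?_ hr0
  have hzj : ‖z j‖ ^ 2 ≤ r ^ 2 := pow_le_pow_left₀ (norm_nonneg _)
    ((norm_le_pi_norm z j).trans (mem_closedBall_zero_iff.1 hz)) 2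
  have hFj : ‖F z j‖ ^ 2 ≤ M ^ 2 :=
    pow_le_pow_left₀ (norm_nonneg _) ((norm_le_pi_norm _ j).trans (hM z hz)) 2
  have hfirst : ⟪z j, F z j⟫ ≤ -c + B * (1 - ‖z j‖ ^ 2) :=
    hF z (closedBall_subset_closedBall hr1 hz) j
  have hsecond : h * ‖F z j‖ ^ 2 ≤ 2 * (c - B * (1 - r ^ 2)) :=
    (mul_le_mul_of_nonneg_left hFj hh).trans hMc
  calc ‖eulerStep F h z j‖ ^ 2 = ‖z j‖ ^ 2 + h * (2 * ⟪z j, F z j⟫) + h * (h * ‖F z j‖ ^ 2) := by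
        rw [eulerStep, Pi.add_apply, Pi.smul_apply, norm_add_sq_real, inner_smul_right, norm_smul,
          mul_pow, Real.norm_eq_abs, sq_abs]
        ring
    _ ≤ ‖z j‖ ^ 2 + h * (2 * (-c + B * (1 - ‖z j‖ ^ 2))) + h * (2 * (c - B * (1 - r ^ 2))) := by
        linarith [mul_le_mul_of_nonneg_left hfirst hh, mul_le_mul_of_nonneg_left hsecond hh]
    _ = ‖z j‖ ^ 2 + h * (2 * B) * (r ^ 2 - ‖z j‖ ^ 2) := by ring
    _ ≤ r ^ 2 := by linarith [mul_le_mul_of_nonneg_right hB (sub_nonneg.2 hzj)]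

theorem eventually_mapsTo_eulerStep (hF : InwardBound F c B)
    (hM : ∀ z ∈ closedBall 0 r, ‖F z‖ ≤ M) (hr0 : 0 ≤ r) (hr1 : r ≤ 1)
    (hrc : B * (1 - r ^ 2) < c) :
    ∀ᶠ h in 𝓝[≥] 0, MapsTo (eulerStep F h) (closedBall 0 r) (closedBall 0 r) := by
  have hsmall (a : ℝ) {b : ℝ} (hb : 0 < b) : ∀ᶠ h : ℝ in 𝓝[≥] 0, h * a ≤ b := by
    have hlim : Tendsto (fun h : ℝ => h * a) (𝓝 0) (𝓝 0) := by
      simpa using (continuous_mul_const a).tendsto 0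
    exact ((hlim.eventually_lt_const hb).mono fun _ => le_of_lt).filter_mono nhdsWithin_le_nhds
  filter_upwards [self_mem_nhdsWithin, hsmall (2 * B) one_pos,
    hsmall (M ^ 2) (b := 2 * (c - B * (1 - r ^ 2))) (by linarith)] with h hh hB hMc
  exact hF.mapsTo_eulerStep hM hr0 hr1 hh hB hMc

end InwardBound

/-! ### Flows of inward fields -/

theorem eventually_forall_le_neg_add_div {X : Type*} [TopologicalSpace X] {K : Set X}
    (hK : IsCompact K) {f g : X → ℝ} (hf : ContinuousOn f K) (hg : ContinuousOn g K)
    (hg0 : ∀ x ∈ K, 0 ≤ g x) (hneg : ∀ x ∈ K, g x = 0 → f x < 0) :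
    ∀ᶠ ε in 𝓝[>] 0, ∀ x ∈ K, f x ≤ -ε + g x / ε := by
  have hpoint : ∀ x ∈ K, ∃ ε > 0, f x < -ε + g x / ε := fun x hx => by
    rcases (hg0 x hx).eq_or_lt' with h0 | hpos
    · exact ⟨-f x / 2, by linarith [hneg x hx h0], by rw [h0, zero_div]; linarith [hneg x hx h0]⟩
    · refine ⟨min 1 (g x / (|f x| + 2)), by positivity, ?_⟩
      have hle : |f x| + 2 ≤ g x / min 1 (g x / (|f x| + 2)) := by
        rw [le_div_comm₀ (by positivity) (by positivity)]
        exact min_le_right _ _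
      linarith [le_abs_self (f x), min_le_left 1 (g x / (|f x| + 2))]
  refine hK.induction_on (p := fun s => ∀ᶠ ε in 𝓝[>] 0, ∀ x ∈ s, x ∈ K → f x ≤ -ε + g x / ε)
    (by simp) (fun s t hst ht => ht.mono fun ε h x hx => h x (hst hx))
    (fun s t hs ht => (hs.and ht).mono fun ε h x hx => hx.elim (h.1 x) (h.2 x))
    (fun x hx => ?_) |>.mono fun ε h x hx => h x hx hx
  obtain ⟨ε₀, hε₀, hlt⟩ := hpoint x hx
  refine ⟨{y | f y < -ε₀ + g y / ε₀},
    (hf x hx).eventually_lt (continuousWithinAt_const.add ((hg x hx).div_const ε₀)) hlt, ?_⟩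
  filter_upwards [Ioc_mem_nhdsGT hε₀] with ε hε y hy hyK
  have hmono : g y / ε₀ ≤ g y / ε := div_le_div_of_nonneg_left (hg0 y hyK) hε.1 hε.2
  exact hy.le.trans (add_le_add (neg_le_neg hε.2) hmono)

theorem exists_mem_Ioo_mul_one_sub_sq_lt (B : ℝ) {c s : ℝ} (hc : 0 < c) (hs : s < 1) :
    ∃ r ∈ Ioo s 1, 0 < r ∧ B * (1 - r ^ 2) < c := by
  have hlim : Tendsto (fun r : ℝ => B * (1 - r ^ 2)) (𝓝 1) (𝓝 0) := by
    have hcont : Continuous fun r : ℝ => B * (1 - r ^ 2) := by fun_prop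
    simpa using hcont.tendsto 1
  obtain ⟨r, hr, hrs, hr0⟩ := ((hlim.eventually_lt_const hc).filter_mono nhdsWithin_le_nhds |>.and
    (inter_mem (Ioo_mem_nhdsLT hs) (Ioo_mem_nhdsLT one_pos))).exists
  exact ⟨r, hrs, hr0.1, hr⟩

/-- A vector field on the closed unit polydisc, holomorphic inside, each coordinate of which points
strictly into the disc wherever that coordinate is unimodular. -/
structure IsInwardField {ι : Type*} [Fintype ι] (F : (ι → ℂ) → ι → ℂ) : Prop where
  continuousOn : ContinuousOn F (closedBall 0 1)
  differentiableOn : DifferentiableOn ℂ F (ball 0 1)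
  inner_neg : ∀ z ∈ closedBall (0 : ι → ℂ) 1, ∀ j, ‖z j‖ = 1 → ⟪z j, F z j⟫ < 0

namespace IsInwardField

variable {ι : Type*} [Fintype ι] {F : (ι → ℂ) → ι → ℂ} {T t r : ℝ} {γ₁ γ₂ : ℝ → ι → ℂ}

theorem uniformContinuousOn (hF : IsInwardField F) : UniformContinuousOn F (ball 0 1) :=
  ((isCompact_closedBall 0 1).uniformContinuousOn_of_continuous hF.continuousOn).mono
    ball_subset_closedBall

theorem exists_norm_le (hF : IsInwardField F) :
    ∃ M, ∀ z ∈ closedBall (0 : ι → ℂ) 1, ‖F z‖ ≤ M :=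
  (isCompact_closedBall 0 1).exists_bound_of_continuousOn hF.continuousOn

theorem exists_inwardBound (hF : IsInwardField F) :
    ∃ c > 0, ∃ B ≥ 0, InwardBound F c B := by
  have hj (j : ι) : ∀ᶠ ε in 𝓝[>] 0, ∀ z ∈ closedBall (0 : ι → ℂ) 1,
      ⟪z j, F z j⟫ ≤ -ε + (1 - ‖z j‖ ^ 2) / ε := by
    refine eventually_forall_le_neg_add_div (isCompact_closedBall 0 1)
      ((continuous_apply j).continuousOn.inner (continuousOn_pi.1 hF.continuousOn j))
      (by fun_prop) (fun z hz => ?_) fun z hz h0 => hF.inner_neg z hz j ?_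
    · exact sub_nonneg.2 (pow_le_one₀ (norm_nonneg _)
        ((norm_le_pi_norm z j).trans (mem_closedBall_zero_iff.1 hz)))
    · exact (pow_eq_one_iff_of_nonneg (norm_nonneg _) two_ne_zero).1 (sub_eq_zero.1 h0).symm
  obtain ⟨ε, hε, hε0⟩ := ((eventually_all.2 hj).and self_mem_nhdsWithin).exists
  refine ⟨ε, hε0, ε⁻¹, inv_nonneg.2 (le_of_lt hε0), fun z hz j => ?_⟩
  simpa only [div_eq_inv_mul] using hε j z hz

theorem exists_norm_solution_le (hF : IsInwardField F) :
    ∃ κ ∈ Ioc (0 : ℝ) 1, ∀ T γ, IsSolutionIn F (closedBall 0 1) T γ →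
      ∀ t ∈ Icc 0 T, ‖γ t‖ ≤ 1 - κ * (t / (1 + t)) := by
  obtain ⟨c, hc, B, hB, hcB⟩ := hF.exists_inwardBound
  exact hcB.exists_norm_solution_le hc hB

theorem exists_norm_solution_sub_le (hF : IsInwardField F) :
    ∃ A C, 0 ≤ A ∧ 0 ≤ C ∧ ∀ T γ₁ γ₂, IsSolutionIn F (closedBall 0 1) T γ₁ →
      IsSolutionIn F (closedBall 0 1) T γ₂ → ∀ η, 0 < η → ‖γ₁ 0 - γ₂ 0‖ ≤ η →
        ∀ t ∈ Icc 0 T, ‖γ₁ t - γ₂ t‖ ≤ singularGronwallBound A C η t := by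
  obtain ⟨M, hM⟩ := hF.exists_norm_le
  obtain ⟨κ, ⟨hκ, -⟩, hdepth⟩ := hF.exists_norm_solution_le
  obtain ⟨C, hC, hlip⟩ := exists_norm_sub_le_of_uniformContinuousOn hF.differentiableOn
    hF.uniformContinuousOn (ε := κ / 4) (by positivity)
  have hM0 : 0 ≤ M := (norm_nonneg _).trans (hM 0 (mem_closedBall_self zero_le_one))
  refine ⟨4 * (2 * M) + 1, 1 / 4 + C, by positivity, by positivity, ?_⟩
  intro T γ₁ γ₂ h₁ h₂ η hη h0
  refine norm_le_singularGronwallBound (f := fun t => γ₁ t - γ₂ t)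
    (f' := fun t => F (γ₁ t) - F (γ₂ t)) (by positivity) (by positivity) hη
    (h₁.continuousOn.sub h₂.continuousOn)
    (fun t ht => (h₁.hasDerivWithinAt_Ici ht).sub (h₂.hasDerivWithinAt_Ici ht)) h0
    (fun t ht => ?_) (fun t ht => ?_)
  · have ht' := Ico_subset_Icc_self ht
    linarith [norm_sub_le (F (γ₁ t)) (F (γ₂ t)), hM _ (h₁.mapsTo ht'), hM _ (h₂.mapsTo ht')]
  · have ht0 : 0 < t := ht.1
    have ht' := Ioo_subset_Icc_self ht
    have hrate : κ / 4 / (κ * (t / (1 + t))) + C = 1 / (4 * t) + (1 / 4 + C) := by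
      field_simp
      ring
    rw [← hrate]
    exact hlip _ (by positivity) _ (mem_closedBall_zero_iff.2 (hdepth T γ₁ h₁ t ht')) _
      (mem_closedBall_zero_iff.2 (hdepth T γ₂ h₂ t ht'))

theorem exists_forall_norm_solution_sub_lt (hF : IsInwardField F) (T : ℝ) {ε : ℝ} (hε : 0 < ε) :
    ∃ δ > 0, ∀ γ₁ γ₂, IsSolutionIn F (closedBall 0 1) T γ₁ →
      IsSolutionIn F (closedBall 0 1) T γ₂ → ‖γ₁ 0 - γ₂ 0‖ ≤ δ →
        ∀ t ∈ Icc 0 T, ‖γ₁ t - γ₂ t‖ < ε := by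
  obtain ⟨A, C, hA, hC, h⟩ := hF.exists_norm_solution_sub_le
  obtain ⟨δ, hδ, hδ0⟩ := (((tendsto_singularGronwallBound_zero A C T).eventually_lt_const
    hε).filter_mono (nhdsWithin_le_nhds (s := Ioi 0)) |>.and self_mem_nhdsWithin).exists
  exact ⟨δ, hδ0, fun γ₁ γ₂ h₁ h₂ h0 t ht => (h T γ₁ γ₂ h₁ h₂ δ hδ0 h0 t ht).trans_lt <|
    (singularGronwallBound_mono hA hC (le_of_lt hδ0) ht.2).trans_lt hδ⟩

theorem solution_unique (hF : IsInwardField F) (h₁ : IsSolutionIn F (closedBall 0 1) T γ₁)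
    (h₂ : IsSolutionIn F (closedBall 0 1) T γ₂) (h0 : γ₁ 0 = γ₂ 0) : EqOn γ₁ γ₂ (Icc 0 T) := by
  intro t ht
  by_contra hne
  obtain ⟨δ, hδ, h⟩ := hF.exists_forall_norm_solution_sub_lt T (norm_sub_pos_iff.2 hne)
  exact (h γ₁ γ₂ h₁ h₂ (by simpa [h0] using hδ.le) t ht).false

theorem exists_isSolutionIn_of_mem_ball (hF : IsInwardField F) (hT : 0 ≤ T) {z : ι → ℂ}
    (hz : z ∈ ball 0 1) : ∃ γ, γ 0 = z ∧ IsSolutionIn F (closedBall 0 1) T γ := by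
  obtain ⟨c, hc, B, -, hcB⟩ := hF.exists_inwardBound
  obtain ⟨r, ⟨hzr, hr1⟩, hr0, hr⟩ :=
    exists_mem_Ioo_mul_one_sub_sq_lt B hc (mem_ball_zero_iff.1 hz)
  obtain ⟨L, hL⟩ :=
    exists_lipschitzOnWith_closedBall hF.differentiableOn hF.uniformContinuousOn hr1
  obtain ⟨γ, h0, hγ⟩ := hcB.exists_isSolutionIn_closedBall hL hr0 hr1.le hr hT
    (mem_closedBall_zero_iff.2 hzr.le)
  exact ⟨γ, h0, hγ.mono_set (closedBall_subset_closedBall hr1.le)⟩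

theorem exists_isSolutionIn (hF : IsInwardField F) (hT : 0 ≤ T) {z : ι → ℂ}
    (hz : z ∈ closedBall 0 1) : ∃ γ, γ 0 = z ∧ IsSolutionIn F (closedBall 0 1) T γ := by
  rw [← closure_ball 0 one_ne_zero] at hz
  obtain ⟨p, hp, hpz⟩ := mem_closure_iff_seq_limit.1 hz
  obtain ⟨M, hM⟩ := hF.exists_norm_le
  choose γ h0 hγ using fun k => hF.exists_isSolutionIn_of_mem_ball hT (hp k)
  have hcauchy : ∀ t ∈ Icc 0 T, CauchySeq fun k => γ k t := fun t ht => by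
    refine Metric.cauchySeq_iff.2 fun ε hε => ?_
    obtain ⟨δ, hδ, hclose⟩ := hF.exists_forall_norm_solution_sub_lt T hε
    obtain ⟨N, hN⟩ := Metric.cauchySeq_iff.1 hpz.cauchySeq δ hδ
    refine ⟨N, fun m hm k hk => ?_⟩
    rw [dist_eq_norm]
    refine hclose _ _ (hγ m) (hγ k) ?_ t ht
    simpa only [h0, dist_eq_norm] using (hN m hm k hk).le
  choose! γ' hγ' using fun t ht => cauchySeq_tendsto_of_complete (hcauchy t ht)
  refine ⟨γ', tendsto_nhds_unique (hγ' 0 ⟨le_rfl, hT⟩) ?_,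
    IsSolutionIn.of_tendsto isClosed_closedBall hF.continuousOn hM hγ hγ'⟩
  simpa only [h0] using hpz

theorem exists_isSolutionFamily (hF : IsInwardField F) :
    ∃ φ, IsSolutionFamily F (closedBall 0 1) φ := by
  choose! σ h0 hσ using fun T (hT : 0 ≤ T) z (hz : z ∈ closedBall (0 : ι → ℂ) 1) =>
    hF.exists_isSolutionIn hT hz
  refine ⟨fun t z => σ t z t, h0 0 le_rfl, fun z hz T => ?_⟩
  rcases lt_or_ge T 0 with hT | hT
  · exact ⟨by simp [hT, mapsTo_empty], by simp [IsIntegralCurveOn, hT]⟩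
  · exact (hσ T hT z hz).congr fun t ht =>
      hF.solution_unique (hσ t ht.1 z hz) ((hσ T hT z hz).mono ht.2)
        ((h0 t ht.1 z hz).trans (h0 T hT z hz).symm) ⟨ht.1, le_rfl⟩

end IsInwardField

namespace IsSolutionFamily

variable {E : Type*} [NormedAddCommGroup E] [NormedSpace ℝ E] {F : E → E} {S : Set E}
  {φ : ℝ → E → E} {z : E}

theorem hasDerivWithinAt (hφ : IsSolutionFamily F S φ) (hz : z ∈ S) {t : ℝ} (ht : 0 ≤ t) :
    HasDerivWithinAt (fun s => φ s z) (F (φ t z)) (Ici 0) t :=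
  ((hφ.isSolutionIn z hz (t + 1)).isIntegralCurveOn t
    ⟨ht, (lt_add_one t).le⟩).mono_of_mem_nhdsWithin
      (inter_mem_nhdsWithin _ (Iic_mem_nhds (lt_add_one t)))

theorem lipschitzOnWith_time (hφ : IsSolutionFamily F S φ) {M : ℝ} (hM : ∀ z ∈ S, ‖F z‖ ≤ M)
    (hz : z ∈ S) : LipschitzOnWith M.toNNReal (fun t => φ t z) (Ici 0) :=
  LipschitzOnWith.of_dist_le' fun t ht s hs => by
    simpa only [dist_eq_norm] using (hφ.isSolutionIn z hz (max t s)).norm_sub_le hM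
      ⟨hs, le_max_right _ _⟩ ⟨ht, le_max_left _ _⟩

end IsSolutionFamily

namespace IsInwardField

variable {ι : Type*} [Fintype ι] {F : (ι → ℂ) → ι → ℂ} {φ : ℝ → (ι → ℂ) → ι → ℂ} {t : ℝ}

theorem flow_add (hF : IsInwardField F) (hφ : IsSolutionFamily F (closedBall 0 1) φ) {s : ℝ}
    (ht : 0 ≤ t) (hs : 0 ≤ s) {z : ι → ℂ} (hz : z ∈ closedBall 0 1) :
    φ (t + s) z = φ t (φ s z) := by
  have hsz : φ s z ∈ closedBall 0 1 := (hφ.isSolutionIn z hz s).mapsTo ⟨hs, le_rfl⟩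
  refine hF.solution_unique ((hφ.isSolutionIn z hz (t + s)).comp_add hs le_rfl)
    (hφ.isSolutionIn _ hsz t) ?_ ⟨ht, le_rfl⟩
  rw [zero_add, hφ.zero _ hsz]

theorem exists_mapsTo_ball (hF : IsInwardField F) (hφ : IsSolutionFamily F (closedBall 0 1) φ)
    (ht : 0 < t) : ∃ R ∈ Ioo (0 : ℝ) 1, MapsTo (φ t) (closedBall 0 1) (ball 0 R) := by
  obtain ⟨κ, ⟨hκ0, hκ1⟩, hdepth⟩ := hF.exists_norm_solution_le
  have hτ0 : 0 < κ * (t / (1 + t)) := by positivity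
  have hτ1 : κ * (t / (1 + t)) ≤ 1 :=
    mul_le_one₀ hκ1 (by positivity) ((div_le_one (by positivity)).2 (by linarith))
  refine ⟨1 - κ * (t / (1 + t)) / 2, ⟨by linarith, by linarith⟩, fun z hz => ?_⟩
  rw [mem_ball_zero_iff]
  linarith [hdepth t _ (hφ.isSolutionIn z hz t) t ⟨ht.le, le_rfl⟩]

theorem continuousOn_flow (hF : IsInwardField F) (hφ : IsSolutionFamily F (closedBall 0 1) φ) :
    ContinuousOn (fun p : ℝ × (ι → ℂ) => φ p.1 p.2) (Ici 0 ×ˢ closedBall 0 1) := by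
  obtain ⟨M, hM⟩ := hF.exists_norm_le
  refine continuousOn_prod_of_continuousOn_lipschitzOnWith (fun p => φ p.1 p.2) M.toNNReal
    (fun t ht => Metric.continuousOn_iff.2 fun z hz ε hε => ?_)
    fun z hz => hφ.lipschitzOnWith_time hM hz
  obtain ⟨δ, hδ, hclose⟩ := hF.exists_forall_norm_solution_sub_lt t hε
  refine ⟨δ, hδ, fun w hw hwz => ?_⟩
  rw [dist_eq_norm] at hwz ⊢
  exact hclose _ _ (hφ.isSolutionIn w hw t) (hφ.isSolutionIn z hz t)
    (by simpa only [hφ.zero w hw, hφ.zero z hz] using hwz.le) t ⟨ht, le_rfl⟩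

theorem differentiableOn_flow (hF : IsInwardField F) (hφ : IsSolutionFamily F (closedBall 0 1) φ)
    (ht : 0 ≤ t) : DifferentiableOn ℂ (φ t) (ball 0 1) := fun z hz => by
  obtain ⟨c, hc, B, -, hcB⟩ := hF.exists_inwardBound
  obtain ⟨r, ⟨hzr, hr1⟩, hr0, hr⟩ :=
    exists_mem_Ioo_mul_one_sub_sq_lt B hc (mem_ball_zero_iff.1 hz)
  obtain ⟨L, hL⟩ :=
    exists_lipschitzOnWith_closedBall hF.differentiableOn hF.uniformContinuousOn hr1
  obtain ⟨M, hM⟩ := hF.exists_norm_le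
  have hsub : closedBall (0 : ι → ℂ) r ⊆ closedBall 0 1 := closedBall_subset_closedBall hr1.le
  have hφr : IsSolutionFamily F (closedBall 0 r) φ :=
    ⟨fun w hw => hφ.zero w (hsub hw), fun w hw T =>
      have hγ := hφ.isSolutionIn w (hsub hw) T
      ⟨hcB.mapsTo_closedBall hr0.le hr hγ ((hφ.zero w (hsub hw)).symm ▸ hw),
        hγ.isIntegralCurveOn⟩⟩
  have hdiff := hφr.differentiableOn_interior
    (hF.differentiableOn.mono (closedBall_subset_ball hr1)) hL (fun w hw => hM w (hsub hw))
    (hcB.eventually_mapsTo_eulerStep (fun w hw => hM w (hsub hw)) hr0.le hr1.le hr) ht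
  rw [interior_closedBall 0 hr0.ne'] at hdiff
  exact (hdiff.differentiableAt (isOpen_ball.mem_nhds
    (mem_ball_zero_iff.2 hzr))).differentiableWithinAt

end IsInwardField

/-! ### Polydiscs -/

theorem openPolydisc_eq_ball (ι : Type) [Fintype ι] : openPolydisc ι = ball 0 1 := by
  ext z
  simp [openPolydisc, pi_norm_lt_iff]

theorem closedPolydisc_eq_closedBall (ι : Type) [Fintype ι] :
    closedPolydisc ι = closedBall 0 1 := by
  ext z
  simp [closedPolydisc, pi_norm_le_iff_of_nonneg]

theorem openPolydisc_subset_closedPolydisc (ι : Type) : openPolydisc ι ⊆ closedPolydisc ι :=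
  fun _ hz k => (hz k).le

theorem unitTorus_subset_closedPolydisc (ι : Type) : unitTorus ι ⊆ closedPolydisc ι :=
  fun _ hz k => (hz k).le

theorem IsInwardField.generatesFlowOn {n : ℕ} {F : (Fin n → ℂ) → Fin n → ℂ}
    {φ : ℝ → (Fin n → ℂ) → Fin n → ℂ} {S : Set (Fin n → ℂ)} (hF : IsInwardField F)
    (hφ : IsSolutionFamily F (closedBall 0 1) φ) (hbS : ball 0 1 ⊆ S) (hS : S ⊆ closedBall 0 1) :
    GeneratesFlowOn F S φ where
  mapsTo t ht z hz := by
    rcases ht.eq_or_lt with rfl | ht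
    · rwa [hφ.zero z (hS hz)]
    · obtain ⟨R, ⟨-, hR⟩, hmaps⟩ := hF.exists_mapsTo_ball hφ ht
      exact hbS (ball_subset_ball hR.le (hmaps (hS hz)))
  zero z hz := hφ.zero z (hS hz)
  add t s ht hs z hz := hF.flow_add hφ ht hs (hS hz)
  continuousOn := (hF.continuousOn_flow hφ).mono (prod_mono_right hS)
  solves z hz t ht := hφ.hasDerivWithinAt (hS hz) ht
  unique z hz T γ hγ h0 hd := hF.solution_unique ⟨hγ.mono_right hS, hd⟩
    (hφ.isSolutionIn z (hS hz) T) (h0.trans (hφ.zero z (hS hz)).symm)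

theorem proposition3p4_general {n : ℕ} {F : (Fin n → ℂ) → Fin n → ℂ} (hF : IsInwardField F) :
    ∃ φ : ℝ → (Fin n → ℂ) → (Fin n → ℂ),
      HolomorphicFlowAssumption F φ ∧ ForwardInvarianceAssumption φ := by
  obtain ⟨φ, hφ⟩ := hF.exists_isSolutionFamily
  have hball := openPolydisc_eq_ball (Fin n)
  have htorus : unitTorus (Fin n) ⊆ closedBall 0 1 :=
    (unitTorus_subset_closedPolydisc _).trans (closedPolydisc_eq_closedBall _).subset
  have hS : openPolydisc (Fin n) ∪ unitTorus (Fin n) ⊆ closedBall 0 1 :=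
    union_subset (hball.subset.trans ball_subset_closedBall) htorus
  refine ⟨φ, ⟨hball ▸ hF.differentiableOn, hF.continuousOn.mono hS,
    hF.generatesFlowOn hφ (hball ▸ subset_union_left) hS,
    hball ▸ (hF.generatesFlowOn hφ subset_rfl ball_subset_closedBall).mapsTo,
    hball ▸ fun t ht => hF.differentiableOn_flow hφ ht⟩, fun t ht => ?_⟩
  obtain ⟨R, hR, hmaps⟩ := hF.exists_mapsTo_ball hφ ht
  refine ⟨R, hR, fun z hz j => mem_ball_zero_iff.2 ?_⟩
  exact (norm_le_pi_norm _ j).trans_lt (mem_ball_zero_iff.1 (hmaps (htorus hz)))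

theorem continuous_deleteCoord {n : ℕ} (j : Fin n) : Continuous (deleteCoord j) :=
  continuous_pi fun i => continuous_apply (i : Fin n)

theorem differentiable_deleteCoord {n : ℕ} (j : Fin n) : Differentiable ℂ (deleteCoord j) :=
  differentiable_pi.2 fun i => differentiable_apply (i : Fin n)

theorem mapsTo_deleteCoord_closedPolydisc {n : ℕ} (j : Fin n) :
    MapsTo (deleteCoord j) (closedPolydisc (Fin n)) (closedPolydisc {i : Fin n // i ≠ j}) :=
  fun _ hz k => hz k

theorem mapsTo_deleteCoord_openPolydisc {n : ℕ} (j : Fin n) :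
    MapsTo (deleteCoord j) (openPolydisc (Fin n)) (openPolydisc {i : Fin n // i ≠ j}) :=
  fun _ hz k => hz k

theorem inner_sub_mul_eq_re_of_norm_eq_one {z u g : ℂ} (hz : ‖z‖ = 1) :
    ⟪z, (z - u) * g⟫ = ((1 - conj z * u) * g).re := by
  have hzz : conj z * z = 1 := by rw [Complex.conj_mul', hz]; simp
  rw [Complex.inner, ← hzz]
  ring_nf

theorem isInwardField_of_forall_apply_eq {n : ℕ} {F : (Fin n → ℂ) → Fin n → ℂ}
    {u : ∀ j : Fin n, ({i : Fin n // i ≠ j} → ℂ) → ℂ} {G : Fin n → (Fin n → ℂ) → ℂ}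
    (hu_cont : ∀ j, ContinuousOn (u j) (closedPolydisc {i : Fin n // i ≠ j}))
    (hu_hol : ∀ j, DifferentiableOn ℂ (u j) (openPolydisc {i : Fin n // i ≠ j}))
    (hG_cont : ∀ j, ContinuousOn (G j) (closedPolydisc (Fin n)))
    (hG_hol : ∀ j, DifferentiableOn ℂ (G j) (openPolydisc (Fin n)))
    (hF : ∀ z ∈ closedPolydisc (Fin n), ∀ j, F z j = (z j - u j (deleteCoord j z)) * G j z)
    (hneg : ∀ z ∈ closedPolydisc (Fin n), ∀ j,
      ‖z j‖ = 1 → ((1 - conj (z j) * u j (deleteCoord j z)) * G j z).re < 0) :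
    IsInwardField F where
  continuousOn := by
    rw [← closedPolydisc_eq_closedBall]
    exact continuousOn_pi.2 fun j => (((continuous_apply j).continuousOn.sub
      ((hu_cont j).comp (continuous_deleteCoord j).continuousOn
        (mapsTo_deleteCoord_closedPolydisc j))).mul (hG_cont j)).congr fun z hz => hF z hz j
  differentiableOn := by
    rw [← openPolydisc_eq_ball]
    exact differentiableOn_pi.2 fun j => (((differentiable_apply j).differentiableOn.sub
      ((hu_hol j).comp (differentiable_deleteCoord j).differentiableOn
        (mapsTo_deleteCoord_openPolydisc j))).mul (hG_hol j)).congr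
          fun z hz => hF z (openPolydisc_subset_closedPolydisc _ hz) j
  inner_neg := by
    rw [← closedPolydisc_eq_closedBall]
    intro z hz j hzj
    rw [hF z hz j, inner_sub_mul_eq_re_of_norm_eq_one hzj]
    exact hneg z hz j hzj

theorem proposition3p4 (n : ℕ)
    (F : (Fin n → ℂ) → (Fin n → ℂ))
    (u : ∀ j : Fin n, ({i : Fin n // i ≠ j} → ℂ) → ℂ)
    (G : Fin n → (Fin n → ℂ) → ℂ)
    (hu_maps : ∀ j, MapsTo (u j) (closedPolydisc {i : Fin n // i ≠ j}) (Metric.closedBall 0 1))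
    (hu_cont : ∀ j, ContinuousOn (u j) (closedPolydisc {i : Fin n // i ≠ j}))
    (hu_hol : ∀ j, DifferentiableOn ℂ (u j) (openPolydisc {i : Fin n // i ≠ j}))
    (hG_cont : ∀ j, ContinuousOn (G j) (closedPolydisc (Fin n)))
    (hG_hol : ∀ j, DifferentiableOn ℂ (G j) (openPolydisc (Fin n)))
    (hF : ∀ z ∈ closedPolydisc (Fin n), ∀ j,
      F z j = (z j - u j (deleteCoord j z)) * G j z)
    (hneg : ∀ z ∈ closedPolydisc (Fin n), ∀ j,
      ((1 - (starRingEnd ℂ) (z j) * u j (deleteCoord j z)) * G j z).re < 0) :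
    ∃ φ : ℝ → (Fin n → ℂ) → (Fin n → ℂ),
      HolomorphicFlowAssumption F φ ∧ ForwardInvarianceAssumption φ :=
  proposition3p4_general <| isInwardField_of_forall_apply_eq hu_cont hu_hol hG_cont hG_hol hF
    fun z hz j _ => hneg z hz j
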